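/- Let $T,N\ge 1$, $K\ge 0$, $J:=2K+1$ and $C>0$. Let $W_0,W_1,Y_1,\dots,W_K,Y_K\in\mathbb R^{TN}$ be prospects, where $\theta=(\theta_{t,n})$ has $T$ equally likely scenarios $t$ and $N$ attributes $n$; put $\Theta=\{W_0,W_1,Y_1,\dots,W_K,Y_K\}$ and $\mathcal E=\{(W_k,Y_k):k\in[K]\}$. For a permutation $\sigma\in\Sigma$ of $[T]$ let $\sigma(\theta)=(\theta_{\sigma(t),n})_{t,n}$; put $\Theta_L=\{\sigma(\theta):\theta\in\Theta,\sigma\in\Sigma\}$ and $\mathcal E_L=\{(\sigma(\theta),\sigma'(\theta')):(\theta,\theta')\in\mathcal E,\ \sigma,\sigma'\in\Sigma\}$. The law invariant value problem is $$(\mathscr P_L)\quad \min_{v\in\mathbb R^{\Theta_L},\,s\in(\mathbb R^{TN})^{\Theta_L}}\ \sum_{\theta\in\Theta_L}v_\theta$$ subject to $v_\theta+\max\{\langle s_\theta,\theta'-\theta\rangle,0\}\ge v_{\theta'}$ for all $\theta\ne\theta'$ in $\Theta_L$; $s_\theta\ge0$ and $\|s_\theta\|_1\le C$ for all $\theta\in\Theta_L$;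 $v_\theta\ge v_{\theta'}$ for all $(\theta,\theta')\in\mathcal E_L$; and $v_{\sigma(W_0)}=0$ for all $\sigma\in\Sigma$. For a prospect $\theta$ and a finite list $\mathcal D$ of pairs $(\theta',v_{\theta'})$ of prospects and real values, let $\mathscr P_{L,LP}(\theta;\mathcal D)$ be the linear program $$\min_{v_\theta\in\mathbb R,\ s\in\mathbb R^{TN},\ y_{\theta'},w_{\theta'}\in\mathbb R^T}\ v_\theta$$ subject to, for all $\theta'\in\mathcal D$, $\mathbf 1^\top y_{\theta'}+\mathbf 1^\top w_{\theta'}-\langle s,\theta\rangle+v_\theta-v_{\theta'}\ge0$ and $\sum_{n}\theta'_n s_n^\top-y_{\theta'}\mathbf 1^\top-\mathbf 1 w_{\theta'}^\top\ge0$ (componentwise, a $T\times T$ matrix, where $\theta'_n,s_n\in\mathbb R^T$ are the columns of attribute $n$); $s\ge0$, $\|s\|_1\le C$; and $v_\theta=v_{\theta'}$ whenever $(\theta,\theta')\in\mathcal E$ and $\theta'\in\mathcal D$. Its value $\mathsf{val}$ is $+\infty$ if it is infeasible and $-\infty$ if it is unbounded. The sorting algorithm starts with $\mathcal D_1=[(W_0,0)]$.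 Given $\mathcal D_j=[(\theta_1,v_{\theta_1}),\dots,(\theta_j,v_{\theta_j})]$, it solves $\mathscr P_{L,LP}(\theta;\mathcal D_j)$ for every $\theta\in\Theta$ not in $\mathcal D_j$, computes $\pi_L(\theta;\mathcal D_j)=\min\{v_{\theta_j},\mathsf{val}(\mathscr P_{L,LP}(\theta;\mathcal D_j))\}$, chooses a maximizer $\theta_{j+1}$ of $\pi_L(\cdot\,;\mathcal D_j)$ (ties broken arbitrarily), sets $v_{\theta_{j+1}}=\pi_L(\theta_{j+1};\mathcal D_j)$ and appends $(\theta_{j+1},v_{\theta_{j+1}})$ to the list. It stops when all of $\Theta$ is sorted. Theorem. (1) For all $\theta$ and $\mathcal D$, $\mathsf{val}(\mathscr P_{L,LP}(\theta;\mathcal D))$ equals the value of the linear program that minimizes $v_\theta$ over $(v_\theta,s)$ subject to the $|\Sigma|$ constraints $v_\theta+\langle s,\sigma(\theta')-\theta\rangle\ge v_{\theta'}$, $\sigma\in\Sigma$, for each $\theta'\in\mathcal D$, together with $s\ge0$, $\|s\|_1\le C$, and $v_\theta=v_{\theta'}$ whenever $(\theta,\theta')\in\mathcal E$ and $\theta'\in\mathcal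 D$. (2) The values $v^*=(v^*_\theta)_{\theta\in\Theta_L}$ at an optimal solution of $\mathscr P_L$ exist, are unique, and satisfy $v^*_{\sigma(\theta)}=v^*_\theta$ for all $\theta\in\Theta_L$ and $\sigma\in\Sigma$. (3) However ties are broken, the sorting algorithm terminates, all values that it assigns are finite, and it returns a list that contains each $\theta\in\Theta$ exactly once, paired with $v^*_\theta$, in order of decreasing values. It solves at most $J^2$, hence $O(J^2)$, instances of the reduced linear program. Every one of them is $\mathscr P_{L,LP}(\theta;\mathcal D_j)$ for some $\theta\in\Theta$ and an initial segment $\mathcal D_j$ of the returned list, and has at most $1+TN+2TJ$ variables and at most $J+JT^2+TN+1+KJ$ constraints. -/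

import Mathlib

open Finset

noncomputable section

namespace LawRobust

/-! ### Prospects, permutations, elicitation data -/

/-- A prospect with `T` equally likely scenarios and `N` attributes, as an element of `ℝ^{TN}`. -/
abbrev Prospect (T N : ℕ) : Type := Fin T → Fin N → ℝ

variable {T N K : ℕ}

/-- The Euclidean inner product on `ℝ^{TN}`. -/
def dot (s x : Prospect T N) : ℝ := ∑ t, ∑ n, s t n * x t n

/-- The `ℓ¹` norm on `ℝ^{TN}`. -/
def l1norm (s : Prospect T N) : ℝ := ∑ t, ∑ n, |s t n|

/-- `σ(x) = (x(ω_{σ(t)}))_t`; one permutation of the scenarios acts on all attributes. -/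
def permute (σ : Equiv.Perm (Fin T)) (x : Prospect T N) : Prospect T N := fun t => x (σ t)

/-- The data of the model: the normalizing prospect `W₀`, the elicited pairs `(W k, Y k)`
(`W k` is weakly preferred to `Y k`), and the Lipschitz modulus `C`. -/
structure Elicitation (T N K : ℕ) where
  W₀ : Prospect T N
  W : Fin K → Prospect T N
  Y : Fin K → Prospect T N
  C : ℝ

namespace Elicitation

/-- `J = 2K + 1`. -/
def J (_d : Elicitation T N K) : ℕ := 2 * K + 1

/-- `Θ = {W₀, W₁, Y₁, …, W_K, Y_K}`. -/
def Theta (d : Elicitation T N K) : Finset (Prospect T N) :=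
  insert d.W₀ (univ.image d.W ∪ univ.image d.Y)

/-- `Θ_L`, the set of all permutations of prospects in `Θ`. -/
def ThetaL (d : Elicitation T N K) : Finset (Prospect T N) :=
  d.Theta.biUnion fun θ => univ.image fun σ : Equiv.Perm (Fin T) => permute σ θ

theorem mem_ThetaL (d : Elicitation T N K) {θ : Prospect T N} (h : θ ∈ d.Theta) :
    θ ∈ d.ThetaL :=
  mem_biUnion.2 ⟨θ, h, mem_image.2 ⟨1, mem_univ _, rfl⟩⟩

/-- Membership in the augmented set of comparisons
`𝓔_L = {(σ(W_k), σ'(Y_k)) : k, σ, σ'}`. -/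
def PairL (d : Elicitation T N K) (θ θ' : Prospect T N) : Prop :=
  ∃ (k : Fin K) (σ σ' : Equiv.Perm (Fin T)), θ = permute σ (d.W k) ∧ θ' = permute σ' (d.Y k)

/-! ### The law invariant value problem `P_L` -/

/-- Feasibility of `(v, s)` for the law invariant value problem. -/
structure ValueFeasible (d : Elicitation T N K) (v : d.ThetaL → ℝ)
    (s : d.ThetaL → Prospect T N) : Prop where
  majorize : ∀ θ θ' : d.ThetaL, θ ≠ θ' →
    v θ' ≤ v θ + max (dot (s θ) (θ'.1 - θ.1)) 0
  nonneg : ∀ (θ : d.ThetaL) (t : Fin T) (n : Fin N), 0 ≤ s θ t n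
  norm_le : ∀ θ : d.ThetaL, l1norm (s θ) ≤ d.C
  elicit : ∀ θ θ' : d.ThetaL, d.PairL θ.1 θ'.1 → v θ' ≤ v θ
  normalize : ∀ (θ : d.ThetaL) (σ : Equiv.Perm (Fin T)), θ.1 = permute σ d.W₀ → v θ = 0

/-- `v` is (the value part of) an optimal solution of the law invariant value problem, which
minimizes `∑_{θ ∈ Θ_L} v_θ` over all feasible `(v, s)`. -/
def ValueOptimal (d : Elicitation T N K) (v : d.ThetaL → ℝ) : Prop :=
  (∃ s, d.ValueFeasible v s) ∧ ∀ v' s', d.ValueFeasible v' s' → ∑ θ, v θ ≤ ∑ θ, v' θ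

end Elicitation

/-! ### Linear programs -/

/-- The linear program `min ∑ cost i * x i` subject to finitely many linear inequalities
`ineqRhs k ≤ ∑ ineqCoeff k i * x i` and equations `∑ eqCoeff e i * x i = eqRhs e`. -/
structure LinearProgram (Var Ineq Eqn : Type) where
  cost : Var → ℝ
  ineqCoeff : Ineq → Var → ℝ
  ineqRhs : Ineq → ℝ
  eqCoeff : Eqn → Var → ℝ
  eqRhs : Eqn → ℝ

namespace LinearProgram

variable {Var Ineq Eqn : Type} [Fintype Var] [Fintype Ineq] [Fintype Eqn]

def Feasible (P : LinearProgram Var Ineq Eqn) (x : Var → ℝ) : Prop :=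
  (∀ k, P.ineqRhs k ≤ ∑ i, P.ineqCoeff k i * x i) ∧ ∀ e, ∑ i, P.eqCoeff e i * x i = P.eqRhs e

/-- The optimal value: `⊤` if the program is infeasible, `⊥` if it is unbounded below. -/
def value (P : LinearProgram Var Ineq Eqn) : EReal :=
  ⨅ (x : Var → ℝ) (_ : P.Feasible x), ((∑ i, P.cost i * x i : ℝ) : EReal)

def numVars (_P : LinearProgram Var Ineq Eqn) : ℕ := Fintype.card Var

def numConstraints (_P : LinearProgram Var Ineq Eqn) : ℕ :=
  Fintype.card Ineq + Fintype.card Eqn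

end LinearProgram

/-! ### The reduced linear program `P_{L,LP}(θ; 𝓓)` -/

/-- An ordered list of sorted prospects together with their values. -/
abbrev SortedList (T N : ℕ) : Type := List (Prospect T N × ℝ)

/-- The variables `v_θ`, `s_{t,n}`, `y_{θ',t}`, `w_{θ',t}` (in this order) of the reduced program
with `j` sorted prospects. -/
abbrev ReducedVar (T N j : ℕ) : Type :=
  Unit ⊕ (Fin T × Fin N) ⊕ (Fin j × Fin T) ⊕ (Fin j × Fin T)

/-- The inequalities of the reduced program: one for every sorted prospect `θ'`, a `T × T` matrix
inequality for every sorted prospect `θ'`, `s ≥ 0`, and `‖s‖₁ ≤ C`. -/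
abbrev ReducedIneq (T N j : ℕ) : Type :=
  Fin j ⊕ (Fin j × Fin T × Fin T) ⊕ (Fin T × Fin N) ⊕ Unit

namespace Elicitation

/-- The equations of the reduced program: one for every elicited pair `(θ, θ')` with `θ'` sorted. -/
abbrev ReducedEqn (d : Elicitation T N K) (θ : Prospect T N) (D : SortedList T N) : Type :=
  {p : Fin K × Fin D.length // d.W p.1 = θ ∧ d.Y p.1 = (D.get p.2).1}

/-- The reduced linear program `P_{L,LP}(θ; 𝓓)`; see `reducedLP_feasible_iff` for its
constraints in the usual notation. As `s ≥ 0`, the constraint `‖s‖₁ ≤ C` is the linear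
constraint `-C ≤ -∑ s_{t,n}`. -/
def reducedLP (d : Elicitation T N K) (θ : Prospect T N) (D : SortedList T N) :
    LinearProgram (ReducedVar T N D.length) (ReducedIneq T N D.length) (d.ReducedEqn θ D) where
  cost
    | .inl _ => 1
    | .inr _ => 0
  ineqCoeff
    | .inl i => fun
      | .inl _ => 1
      | .inr (.inl (t, n)) => -θ t n
      | .inr (.inr (.inl (i', _))) => if i' = i then 1 else 0
      | .inr (.inr (.inr (i', _))) => if i' = i then 1 else 0
    | .inr (.inl (i, t, u)) => fun
      | .inl _ => 0
      | .inr (.inl (u', n)) => if u' = u then (D.get i).1 t n else 0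
      | .inr (.inr (.inl (i', t'))) => if i' = i ∧ t' = t then -1 else 0
      | .inr (.inr (.inr (i', u'))) => if i' = i ∧ u' = u then -1 else 0
    | .inr (.inr (.inl (t, n))) => fun
      | .inr (.inl (t', n')) => if t' = t ∧ n' = n then 1 else 0
      | _ => 0
    | .inr (.inr (.inr _)) => fun
      | .inr (.inl _) => -1
      | _ => 0
  ineqRhs
    | .inl i => (D.get i).2
    | .inr (.inr (.inr _)) => -d.C
    | _ => 0
  eqCoeff _ := fun
    | .inl _ => 1
    | .inr _ => 0
  eqRhs e := (D.get e.1.2).2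

/-- The constraints of the reduced program in the usual notation; `i` runs through the sorted
prospects `θ' = (D.get i).1`, and `(D.get i).2` is the value of `θ'`. -/
theorem reducedLP_feasible_iff (d : Elicitation T N K) (θ : Prospect T N) (D : SortedList T N)
    (v : ℝ) (s : Prospect T N) (y w : Fin D.length → Fin T → ℝ) :
    (d.reducedLP θ D).Feasible
      (Sum.elim (fun _ => v) (Sum.elim (fun p => s p.1 p.2)
        (Sum.elim (fun p => y p.1 p.2) (fun p => w p.1 p.2)))) ↔
    (∀ i, 0 ≤ ∑ t, y i t + ∑ t, w i t - dot s θ + v - (D.get i).2) ∧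
    (∀ i t u, 0 ≤ ∑ n, (D.get i).1 t n * s u n - y i t - w i u) ∧
    (∀ t n, 0 ≤ s t n) ∧ l1norm s ≤ d.C ∧
    (∀ k i, d.W k = θ → d.Y k = (D.get i).1 → v = (D.get i).2) := by
  have e1 : (∀ i, (d.reducedLP θ D).ineqRhs (.inl i) ≤ ∑ x, (d.reducedLP θ D).ineqCoeff (.inl i) x *
      (Sum.elim (fun _ => v) (Sum.elim (fun p => s p.1 p.2)
        (Sum.elim (fun p => y p.1 p.2) (fun p => w p.1 p.2))) : ReducedVar T N D.length → ℝ) x) ↔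
      (∀ i, 0 ≤ ∑ t, y i t + ∑ t, w i t - dot s θ + v - (D.get i).2) := by
    refine forall_congr' fun i => ?_
    have hd : ∑ x, ∑ x_1, θ x x_1 * s x x_1 = dot s θ := by simp only [dot, mul_comm]
    simp only [reducedLP, Fintype.sum_sum_type, Sum.elim_inl, Sum.elim_inr, Fintype.sum_prod_type,
      ite_mul, one_mul, zero_mul, neg_mul, sum_neg_distrib, univ_unique, sum_singleton, hd]
    have hs : ∀ f : Fin D.length → Fin T → ℝ,
        (∑ x, ∑ x_1, if x = i then f x x_1 else 0) = ∑ t, f i t := by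
      intro f
      rw [sum_eq_single i] <;> simp +contextual
    rw [hs, hs]
    constructor <;> intro h <;> linarith
  have e2 : (∀ i t u, (d.reducedLP θ D).ineqRhs (.inr (.inl (i, t, u))) ≤
      ∑ x, (d.reducedLP θ D).ineqCoeff (.inr (.inl (i, t, u))) x *
      (Sum.elim (fun _ => v) (Sum.elim (fun p => s p.1 p.2)
        (Sum.elim (fun p => y p.1 p.2) (fun p => w p.1 p.2))) : ReducedVar T N D.length → ℝ) x) ↔
      (∀ i t u, 0 ≤ ∑ n, (D.get i).1 t n * s u n - y i t - w i u) := by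
    refine forall_congr' fun i => forall_congr' fun t => forall_congr' fun u => ?_
    simp only [reducedLP, Fintype.sum_sum_type, Sum.elim_inl, Sum.elim_inr, Fintype.sum_prod_type,
      ite_mul, one_mul, zero_mul, neg_mul, sum_const_zero]
    have hs : ∀ (f : Fin D.length → Fin T → ℝ) (u : Fin T),
        (∑ x, ∑ x_1, if x = i ∧ x_1 = u then -f x x_1 else 0) = -f i u := by
      intro f u
      rw [sum_eq_single i, sum_eq_single u] <;> simp +contextual
    have hs' : (∑ x, ∑ x_1, if x = u then (D.get i).1 t x_1 * s x x_1 else 0)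
        = ∑ n, (D.get i).1 t n * s u n := by
      rw [sum_eq_single u] <;> simp +contextual
    rw [hs, hs, hs']
    constructor <;> intro h <;> linarith
  have e3 : (∀ t n, (d.reducedLP θ D).ineqRhs (.inr (.inr (.inl (t, n)))) ≤
      ∑ x, (d.reducedLP θ D).ineqCoeff (.inr (.inr (.inl (t, n)))) x *
      (Sum.elim (fun _ => v) (Sum.elim (fun p => s p.1 p.2)
        (Sum.elim (fun p => y p.1 p.2) (fun p => w p.1 p.2))) : ReducedVar T N D.length → ℝ) x) ↔
      (∀ t n, 0 ≤ s t n) := by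
    refine forall_congr' fun t => forall_congr' fun n => ?_
    simp only [reducedLP, Fintype.sum_sum_type, Sum.elim_inl, Sum.elim_inr, Fintype.sum_prod_type,
      ite_mul, one_mul, zero_mul, sum_const_zero]
    have hs : (∑ x, ∑ x_1, if x = t ∧ x_1 = n then s x x_1 else 0) = s t n := by
      rw [sum_eq_single t, sum_eq_single n] <;> simp +contextual
    rw [hs]
    constructor <;> intro h <;> linarith
  have e4 : (d.reducedLP θ D).ineqRhs (.inr (.inr (.inr ()))) ≤
      ∑ x, (d.reducedLP θ D).ineqCoeff (.inr (.inr (.inr ()))) x *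
      (Sum.elim (fun _ => v) (Sum.elim (fun p => s p.1 p.2)
        (Sum.elim (fun p => y p.1 p.2) (fun p => w p.1 p.2))) : ReducedVar T N D.length → ℝ) x ↔
      ∑ t, ∑ n, s t n ≤ d.C := by
    simp only [reducedLP, Fintype.sum_sum_type, Sum.elim_inl, Sum.elim_inr, Fintype.sum_prod_type,
      zero_mul, sum_const_zero, neg_mul, one_mul, sum_neg_distrib]
    constructor <;> intro h <;> linarith
  have e5 : (∀ e, ∑ x, (d.reducedLP θ D).eqCoeff e x *
      (Sum.elim (fun _ => v) (Sum.elim (fun p => s p.1 p.2)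
        (Sum.elim (fun p => y p.1 p.2) (fun p => w p.1 p.2))) : ReducedVar T N D.length → ℝ) x =
      (d.reducedLP θ D).eqRhs e) ↔
      (∀ k i, d.W k = θ → d.Y k = (D.get i).1 → v = (D.get i).2) := by
    simp only [reducedLP, Fintype.sum_sum_type, Sum.elim_inl, Sum.elim_inr,
      one_mul, zero_mul, sum_const_zero, univ_unique, sum_singleton, add_zero]
    exact ⟨fun h k i h1 h2 => h ⟨(k, i), h1, h2⟩, fun h e => h e.1.1 e.1.2 e.2.1 e.2.2⟩
  unfold LinearProgram.Feasible
  rw [e5, Sum.forall, Sum.forall, Sum.forall, e1, Prod.forall]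
  simp only [Prod.forall]
  rw [e2, e3]
  have e6 : (∀ t n, 0 ≤ s t n) → (l1norm s ≤ d.C ↔ ∑ t, ∑ n, s t n ≤ d.C) := by
    intro h
    simp only [l1norm, abs_of_nonneg (h _ _)]
  constructor
  · rintro ⟨⟨h1, h2, h3, h4⟩, h5⟩
    exact ⟨h1, h2, h3, (e6 h3).2 (e4.1 (h4 ())), h5⟩
  · rintro ⟨h1, h2, h3, h4, h5⟩
    exact ⟨⟨h1, h2, h3, fun _ => e4.2 ((e6 h3).1 h4)⟩, h5⟩

/-- Feasibility of `(v, s)` for the linear program `P_{LP}(θ; Σ(𝓓))`, which has one constraint for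
every sorted prospect and every permutation of the scenarios. -/
structure PermFeasible (d : Elicitation T N K) (θ : Prospect T N) (D : SortedList T N)
    (v : ℝ) (s : Prospect T N) : Prop where
  majorize : ∀ p ∈ D, ∀ σ : Equiv.Perm (Fin T), p.2 ≤ v + dot s (permute σ p.1 - θ)
  nonneg : ∀ t n, 0 ≤ s t n
  norm_le : l1norm s ≤ d.C
  elicit : ∀ p ∈ D, ∀ k, d.W k = θ → d.Y k = p.1 → v = p.2

/-- The optimal value of `P_{LP}(θ; Σ(𝓓))`. -/
def permLPValue (d : Elicitation T N K) (θ : Prospect T N) (D : SortedList T N) : EReal :=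
  ⨅ (v : ℝ) (s : Prospect T N) (_ : d.PermFeasible θ D v s), (v : EReal)

end Elicitation

/-! ### Programs that query an oracle -/

/-- A program that may ask an oracle questions `q : Q`, receives answers in `A`, and finally
returns a result in `α`. -/
inductive OracleProg (Q A α : Type) : Type where
  | done (a : α) : OracleProg Q A α
  | ask (q : Q) (next : A → OracleProg Q A α) : OracleProg Q A α

namespace OracleProg

variable {Q A α β : Type}

/-- Sequential composition. -/
def bind : OracleProg Q A α → (α → OracleProg Q A β) → OracleProg Q A β
  | done a, f => f a
  | ask q next, f => ask q fun r => (next r).bind f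

/-- Execution with a given oracle: the result, and the list of all questions asked, in order. -/
def exec (oracle : Q → A) : OracleProg Q A α → α × List Q
  | done a => (a, [])
  | ask q next =>
    let r := (next (oracle q)).exec oracle
    (r.1, q :: r.2)

end OracleProg

/-! ### The law invariant sorting algorithm -/

/-- The pair `(θ, 𝓓)` stands for the instance `P_{L,LP}(θ; 𝓓)`. -/
abbrev Query (T N : ℕ) : Type := Prospect T N × SortedList T N

/-- A rule which selects one of the candidates, given the prospects sorted so far and the list of
all candidates with their predicted values. -/
abbrev SelectionRule (T N : ℕ) : Type :=
  SortedList T N → List (Prospect T N × EReal) → Prospect T N × EReal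

/-- The rule always selects a candidate with the largest predicted value; ties may be broken in any
way. -/
def SelectionRule.IsArgmax (pick : SelectionRule T N) : Prop :=
  ∀ D c, c ≠ [] → pick D c ∈ c ∧ ∀ p ∈ c, p.2 ≤ (pick D c).2

namespace Elicitation

/-- The prospects in `Θ` that are not yet sorted. -/
def unsorted (d : Elicitation T N K) (D : SortedList T N) : Finset (Prospect T N) :=
  d.Theta.filter fun θ => θ ∉ D.map Prod.fst

/-- For every prospect `θ` in a list, solve `P_{L,LP}(θ; 𝓓)` and return the predictor
`π_L(θ; 𝓓) = min {last, val P_{L,LP}(θ; 𝓓)}`, where `last` is the value of the prospect that was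
sorted last. -/
def predictAll (D : SortedList T N) (last : ℝ) :
    List (Prospect T N) → OracleProg (Query T N) EReal (List (Prospect T N × EReal))
  | [] => .done []
  | θ :: rest => .ask (θ, D) fun val =>
      (predictAll D last rest).bind fun c => .done ((θ, min (last : EReal) val) :: c)

/-- The main loop, run for a given number of further iterations. In every iteration an unsorted
prospect with the largest predictor is appended, with its predictor as its value. The program
aborts (with `none`) should this predictor be infinite. -/
def sortLoop (d : Elicitation T N K) (pick : SelectionRule T N) :
    ℕ → SortedList T N → ℝ → OracleProg (Query T N) EReal (Option (SortedList T N))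
  | 0, D, _ => .done (some D)
  | m + 1, D, last => (predictAll D last (d.unsorted D).toList).bind fun c =>
      let next := pick D c
      if next.2 = ⊥ ∨ next.2 = ⊤ then .done none
      else sortLoop d pick m (D ++ [(next.1, next.2.toReal)]) next.2.toReal

/-- The law invariant sorting algorithm: start with `[(W₀, 0)]` and iterate until all prospects in
`Θ` are sorted. -/
def sortingAlgorithm (d : Elicitation T N K) (pick : SelectionRule T N) :
    OracleProg (Query T N) EReal (Option (SortedList T N)) :=
  d.sortLoop pick (d.Theta.card - 1) [(d.W₀, 0)] 0

/-- The oracle that solves instances of the reduced linear program. -/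
def lpOracle (d : Elicitation T N K) (q : Query T N) : EReal := (d.reducedLP q.1 q.2).value

/-- `D` is a decomposition of `Θ` for the values `v`: it lists every `θ ∈ Θ` exactly once, paired
with `v_θ`, in order of decreasing values. -/
structure IsDecomposition (d : Elicitation T N K) (v : d.ThetaL → ℝ) (D : SortedList T N) :
    Prop where
  nodup : (D.map Prod.fst).Nodup
  mem_iff : ∀ θ, θ ∈ D.map Prod.fst ↔ θ ∈ d.Theta
  value_eq : ∀ (θ : Prospect T N) (h : θ ∈ d.Theta), (θ, v ⟨θ, d.mem_ThetaL h⟩) ∈ D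
  sorted : D.Pairwise fun p q => q.2 ≤ p.2

end Elicitation

end LawRobust

end

namespace LawRobust

/-! ### Assignment duality -/

/-- Dual feasible potentials of an assignment problem with larger total weight exist as long as
Hall's condition fails for the tight edges. -/
theorem exists_larger_potentials {ι : Type*} [Fintype ι] [DecidableEq ι] (M : ι → ι → ℝ)
    (y w : ι → ℝ) (h : ∀ t u, y t + w u ≤ M t u) (A : Finset ι)
    (hA : #(A.biUnion fun t => univ.filter fun u => y t + w u = M t u) < #A) :
    ∃ y' w' : ι → ℝ, (∀ t u, y' t + w' u ≤ M t u) ∧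
      ∑ t, y t + ∑ u, w u < ∑ t, y' t + ∑ u, w' u := by
  set B := A.biUnion fun t => univ.filter fun u => y t + w u = M t u with hB
  -- `ε` is at most the slack of every edge that is not tight. Raising `y` by `ε` on `A` and
  -- lowering `w` by `ε` on its tight neighbours `B` preserves feasibility and changes the total by
  -- `ε (#A - #B) > 0`.
  obtain ⟨ε, hε, hεM⟩ : ∃ ε > 0, ∀ t u, y t + w u < M t u → y t + w u + ε ≤ M t u := by
    have key : ∀ᶠ ε in nhdsWithin (0 : ℝ) (Set.Ioi 0), ∀ t u,
        y t + w u < M t u → y t + w u + ε ≤ M t u := by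
      refine Filter.eventually_all.2 fun t => Filter.eventually_all.2 fun u => ?_
      by_cases hlt : y t + w u < M t u
      · have : ∀ᶠ ε in nhds (0 : ℝ), ε < M t u - (y t + w u) := eventually_lt_nhds (by linarith)
        filter_upwards [nhdsWithin_le_nhds this] with ε hε _
        linarith
      · exact Filter.Eventually.of_forall fun ε hε => absurd hε hlt
    obtain ⟨ε, h1, h2⟩ := (key.and self_mem_nhdsWithin).exists
    exact ⟨ε, h2, h1⟩
  refine ⟨fun t => y t + if t ∈ A then ε else 0, fun u => w u - if u ∈ B then ε else 0, ?_, ?_⟩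
  · intro t u
    have htu := h t u
    by_cases ht : t ∈ A <;> by_cases hu : u ∈ B <;> simp only [ht, hu, if_true, if_false]
    · linarith
    · have : y t + w u ≠ M t u := fun he =>
        hu (mem_biUnion.2 ⟨t, ht, mem_filter.2 ⟨mem_univ _, he⟩⟩)
      linarith [hεM t u (lt_of_le_of_ne htu this)]
    · linarith
    · linarith
  · have hc : (#B : ℝ) < #A := by exact_mod_cast hA
    simp only [sum_add_distrib, sum_sub_distrib, sum_ite_mem, univ_inter, sum_const, nsmul_eq_mul]
    nlinarith

/-- Among the dual feasible potentials of an assignment problem, some have largest total weight. -/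
theorem exists_maximal_potentials {ι : Type*} [Fintype ι] (M : ι → ι → ℝ) :
    ∃ y w : ι → ℝ, (∀ t u, y t + w u ≤ M t u) ∧
      ∀ y' w' : ι → ℝ, (∀ t u, y' t + w' u ≤ M t u) →
        ∑ t, y' t + ∑ u, w' u ≤ ∑ t, y t + ∑ u, w u := by
  classical
  rcases isEmpty_or_nonempty ι with _ | ⟨⟨u₀⟩⟩
  · exact ⟨0, 0, fun t => isEmptyElim t, fun y' w' _ => by simp⟩
  set B : ℝ := ∑ t, ∑ u, |M t u| with hB
  have hM : ∀ t u, |M t u| ≤ B := fun t u =>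
    (single_le_sum (f := fun u => |M t u|) (fun _ _ => abs_nonneg _) (mem_univ u)).trans
      (single_le_sum (f := fun t => ∑ u, |M t u|)
        (fun _ _ => sum_nonneg fun _ _ => abs_nonneg _) (mem_univ t))
  have hB0 : 0 ≤ B := (abs_nonneg _).trans (hM u₀ u₀)
  -- `b` is the total of the feasible potentials `(-B, 0)`. Moving a constant from `w` to `y`
  -- changes neither feasibility nor the total, so the search may be restricted to `w u₀ = 0` and
  -- totals of at least `b`. This set is compact.
  set b : ℝ := ∑ _t : ι, -B + ∑ _u : ι, (0 : ℝ) with hb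
  set n : ℝ := (Fintype.card ι : ℝ) with hn
  have hbn : b = -(n * B) := by simp [hb, hn]
  let G : Set ((ι → ℝ) × (ι → ℝ)) := {x | (∀ t u, x.1 t + x.2 u ≤ M t u) ∧ x.2 u₀ = 0 ∧
    b ≤ ∑ t, x.1 t + ∑ u, x.2 u}
  have hclosed : IsClosed G := by
    have hG : G = (⋂ t, ⋂ u, {x | x.1 t + x.2 u ≤ M t u}) ∩ ({x | x.2 u₀ = 0} ∩
        {x | b ≤ ∑ t, x.1 t + ∑ u, x.2 u}) := by
      ext x; simp [G]
    rw [hG]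
    exact (isClosed_iInter fun t => isClosed_iInter fun u =>
      isClosed_le (by fun_prop) continuous_const).inter
        ((isClosed_eq (by fun_prop) continuous_const).inter
          (isClosed_le continuous_const (by fun_prop)))
  have hpair : ∀ x ∈ G, ∀ t u, -((2 * n) * B) ≤ x.1 t + x.2 u := by
    rintro x ⟨h1, -, h3⟩ t u
    -- The swap pairs `t` with `u`. The other summands are at most `B` each, so the lower bound on
    -- the total bounds this one pair from below.
    have hs : ∑ v, (x.1 (Equiv.swap t u v) + x.2 v) = ∑ t, x.1 t + ∑ u, x.2 u := by
      rw [sum_add_distrib, Equiv.sum_comp]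
    rw [← add_sum_erase _ _ (mem_univ u), Equiv.swap_apply_right] at hs
    have hr : ∑ v ∈ univ.erase u, (x.1 (Equiv.swap t u v) + x.2 v) ≤ n * B := by
      calc _ ≤ ∑ v ∈ univ.erase u, B :=
            sum_le_sum fun v _ => (h1 _ _).trans ((le_abs_self _).trans (hM _ _))
        _ ≤ ∑ v : ι, B := sum_le_sum_of_subset_of_nonneg (erase_subset _ _) fun _ _ _ => hB0
        _ = n * B := by simp [hn]
    linarith
  have hn1 : 1 ≤ n := by
    have : 0 < Fintype.card ι := Fintype.card_pos_iff.2 ⟨u₀⟩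
    rw [hn]; exact_mod_cast this
  have hsub : G ⊆ Set.Icc (fun _ => -(3 * n * B), fun _ => -(3 * n * B))
      (fun _ => 3 * n * B, fun _ => 3 * n * B) := by
    intro x hx
    have hp := hpair x hx
    obtain ⟨h1, h2, -⟩ := hx
    have hnB : B ≤ n * B := by nlinarith
    have hu : ∀ t u, x.1 t + x.2 u ≤ B := fun t u =>
      (h1 t u).trans ((le_abs_self _).trans (hM t u))
    refine ⟨⟨fun t => ?_, fun u => ?_⟩, ⟨fun t => ?_, fun u => ?_⟩⟩ <;> dsimp only
    · have := hp t u₀; rw [h2] at this; linarith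
    · have := hp u₀ u; have h' := hu u₀ u₀; rw [h2] at h'; linarith
    · have := hu t u₀; rw [h2] at this; linarith
    · have := hu u₀ u; have h' := hp u₀ u₀; rw [h2] at h'; linarith
  have hcomp : IsCompact G := isCompact_Icc.of_isClosed_subset hclosed hsub
  have hne : G.Nonempty :=
    ⟨(fun _ => -B, fun _ => 0), fun t u => by
      have := neg_abs_le (M t u); have := hM t u; dsimp only; linarith, rfl, le_rfl⟩
  obtain ⟨x, hx, hmax⟩ := hcomp.exists_isMaxOn hne
    (f := fun x => ∑ t, x.1 t + ∑ u, x.2 u) (by fun_prop)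
  refine ⟨x.1, x.2, hx.1, fun y' w' h => ?_⟩
  by_contra! hlt
  have hsum : ∑ t, (y' t + w' u₀) + ∑ u, (w' u - w' u₀) = ∑ t, y' t + ∑ u, w' u := by
    simp only [sum_add_distrib, sum_sub_distrib]; ring
  have hmem : ((fun t => y' t + w' u₀, fun u => w' u - w' u₀) : (ι → ℝ) × (ι → ℝ)) ∈ G :=
    ⟨fun t u => by have := h t u; dsimp only; linarith, sub_self _, by
      dsimp only; rw [hsum]; exact hx.2.2.trans hlt.le⟩
  have h4 := hmax hmem
  simp only [Set.mem_ofPred_eq] at h4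
  linarith

/-- Strong duality for the assignment problem. -/
theorem exists_potentials_eq_assignment {ι : Type*} [Fintype ι] (M : ι → ι → ℝ) :
    ∃ (y w : ι → ℝ) (σ : Equiv.Perm ι), (∀ t u, y t + w u ≤ M t u) ∧
      ∑ t, y t + ∑ u, w u = ∑ u, M (σ u) u := by
  classical
  obtain ⟨y, w, h, hmax⟩ := exists_maximal_potentials M
  have hall : ∀ A : Finset ι, #A ≤ #(A.biUnion fun t => univ.filter fun u => y t + w u = M t u) := by
    intro A
    by_contra! hA
    obtain ⟨y', w', h', hlt⟩ := exists_larger_potentials M y w h A hA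
    exact (hmax y' w' h').not_gt hlt
  -- Maximality forces Hall's condition on the tight edges. A perfect matching of tight edges is an
  -- assignment whose cost is the total of the potentials.
  obtain ⟨f, hf, hfM⟩ := (Finset.all_card_le_biUnion_card_iff_exists_injective _).1 hall
  let e : Equiv.Perm ι := Equiv.ofBijective f (Finite.injective_iff_bijective.1 hf)
  refine ⟨y, w, e.symm, h, ?_⟩
  rw [← Equiv.sum_comp e fun u => M (e.symm u) u, ← Equiv.sum_comp e w, ← sum_add_distrib]
  refine sum_congr rfl fun t _ => ?_
  rw [Equiv.symm_apply_apply]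
  exact (mem_filter.1 (hfM t)).2

/-! ### Permutations of scenarios -/

variable {T N K : ℕ}

/-- Permutations act by precomposition, hence from the right: the factors change order. -/
theorem permute_permute (σ τ : Equiv.Perm (Fin T)) (x : Prospect T N) :
    permute σ (permute τ x) = permute (τ * σ) x := rfl

theorem permute_one (x : Prospect T N) : permute 1 x = x := rfl

theorem permute_inv_permute (σ : Equiv.Perm (Fin T)) (x : Prospect T N) :
    permute σ⁻¹ (permute σ x) = x := by
  rw [permute_permute, mul_inv_cancel, permute_one]

theorem permute_permute_inv (σ : Equiv.Perm (Fin T)) (x : Prospect T N) :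
    permute σ (permute σ⁻¹ x) = x := by
  rw [permute_permute, inv_mul_cancel, permute_one]

theorem permute_sub (σ : Equiv.Perm (Fin T)) (x y : Prospect T N) :
    permute σ (x - y) = permute σ x - permute σ y := rfl

theorem dot_permute_permute (σ : Equiv.Perm (Fin T)) (s x : Prospect T N) :
    dot (permute σ s) (permute σ x) = dot s x :=
  Equiv.sum_comp σ fun t => ∑ n, s t n * x t n

theorem l1norm_permute (σ : Equiv.Perm (Fin T)) (s : Prospect T N) :
    l1norm (permute σ s) = l1norm s :=
  Equiv.sum_comp σ fun t => ∑ n, |s t n|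

theorem dot_sub (s x y : Prospect T N) : dot s (x - y) = dot s x - dot s y := by
  simp only [dot, Pi.sub_apply, mul_sub, sum_sub_distrib]

theorem dot_permute_eq (σ : Equiv.Perm (Fin T)) (s x : Prospect T N) :
    dot s (permute σ x) = ∑ u, ∑ n, x (σ u) n * s u n := by
  simp only [dot, permute, mul_comm]

/-! ### The reduced linear program -/

namespace Elicitation

/-- Weak duality: the entries `(σ u, u)` of the matrix inequality are summed over `u`. -/
theorem permFeasible_of_reduced (d : Elicitation T N K) {θ : Prospect T N} {D : SortedList T N}
    {v : ℝ} {s : Prospect T N} {y w : Fin D.length → Fin T → ℝ}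
    (h1 : ∀ i, 0 ≤ ∑ t, y i t + ∑ t, w i t - dot s θ + v - (D.get i).2)
    (h2 : ∀ i t u, 0 ≤ ∑ n, (D.get i).1 t n * s u n - y i t - w i u)
    (h3 : ∀ t n, 0 ≤ s t n) (h4 : l1norm s ≤ d.C)
    (h5 : ∀ k i, d.W k = θ → d.Y k = (D.get i).1 → v = (D.get i).2) :
    d.PermFeasible θ D v s where
  majorize p hp σ := by
    obtain ⟨i, rfl⟩ := List.mem_iff_get.1 hp
    have hs : ∑ t, y i t + ∑ t, w i t ≤ dot s (permute σ (D.get i).1) := by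
      rw [dot_permute_eq, ← Equiv.sum_comp σ (y i), ← sum_add_distrib]
      exact sum_le_sum fun u _ => by linarith [h2 i (σ u) u]
    rw [dot_sub]
    linarith [h1 i]
  nonneg := h3
  norm_le := h4
  elicit p hp k hW hY := by
    obtain ⟨i, rfl⟩ := List.mem_iff_get.1 hp
    exact h5 k i hW hY

/-- Strong duality: optimal potentials have total `⟨s, σ(θ')⟩` for one particular `σ`, and the
constraint for this `σ` is the aggregated one. -/
theorem PermFeasible.exists_reduced {d : Elicitation T N K} {θ : Prospect T N}
    {D : SortedList T N} {v : ℝ} {s : Prospect T N} (h : d.PermFeasible θ D v s) :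
    ∃ y w : Fin D.length → Fin T → ℝ,
      (∀ i, 0 ≤ ∑ t, y i t + ∑ t, w i t - dot s θ + v - (D.get i).2) ∧
      (∀ i t u, 0 ≤ ∑ n, (D.get i).1 t n * s u n - y i t - w i u) := by
  have := fun i : Fin D.length =>
    exists_potentials_eq_assignment fun t u => ∑ n, (D.get i).1 t n * s u n
  choose y w σ hle hsum using this
  refine ⟨y, w, fun i => ?_, fun i t u => by linarith [hle i t u]⟩
  have := h.majorize _ (D.get_mem i) (σ i)
  rw [dot_sub, dot_permute_eq, ← hsum i] at this
  linarith

theorem sum_reducedLP_cost (d : Elicitation T N K) (θ : Prospect T N) (D : SortedList T N)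
    (x : ReducedVar T N D.length → ℝ) : ∑ i, (d.reducedLP θ D).cost i * x i = x (.inl ()) := by
  simp [reducedLP, Fintype.sum_sum_type]

/-- Feasible points of either program give feasible points of the other with the same objective.
Comparing infima in `EReal` covers infeasible and unbounded programs as well. -/
theorem reducedLP_value_eq (d : Elicitation T N K) (θ : Prospect T N) (D : SortedList T N) :
    (d.reducedLP θ D).value = d.permLPValue θ D := by
  refine le_antisymm ?_ ?_
  · refine le_iInf fun v => le_iInf fun s => le_iInf fun h => ?_
    obtain ⟨y, w, h1, h2⟩ := h.exists_reduced
    refine iInf₂_le_of_le _ ((d.reducedLP_feasible_iff θ D v s y w).2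
      ⟨h1, h2, h.nonneg, h.norm_le, fun k i hW hY => h.elicit _ (D.get_mem i) k hW hY⟩) ?_
    rw [sum_reducedLP_cost]
    exact le_rfl
  · refine le_iInf₂ fun x hx => ?_
    have hx' : x = Sum.elim (fun _ => x (.inl ())) (Sum.elim (fun p => x (.inr (.inl (p.1, p.2))))
        (Sum.elim (fun p => x (.inr (.inr (.inl (p.1, p.2)))))
          (fun p => x (.inr (.inr (.inr (p.1, p.2))))))) := by
      funext i
      rcases i with _ | _ | _ | _ <;> rfl
    rw [hx'] at hx
    obtain ⟨h1, h2, h3, h4, h5⟩ := (d.reducedLP_feasible_iff θ D (x (.inl ()))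
      (fun t n => x (.inr (.inl (t, n)))) (fun i t => x (.inr (.inr (.inl (i, t)))))
      (fun i t => x (.inr (.inr (.inr (i, t)))))).1 hx
    rw [sum_reducedLP_cost]
    exact iInf_le_of_le _ (iInf_le_of_le _
      (iInf_le_of_le (d.permFeasible_of_reduced h1 h2 h3 h4 h5) le_rfl))

/-! ### Values of the program with all permutation constraints -/

/-- `s` is an admissible slope at `θ` with value `c`: it satisfies the majorization constraints for
the prospects in `D`. -/
structure IsSlope (d : Elicitation T N K) (D : Set (Prospect T N × ℝ)) (θ : Prospect T N)
    (c : ℝ) (s : Prospect T N) : Prop where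
  majorize : ∀ p ∈ D, ∀ σ : Equiv.Perm (Fin T), p.2 ≤ c + dot s (permute σ p.1 - θ)
  nonneg : ∀ t n, 0 ≤ s t n
  norm_le : l1norm s ≤ d.C

theorem abs_le_of_l1norm_le {s : Prospect T N} {c : ℝ} (h : l1norm s ≤ c) (t : Fin T)
    (n : Fin N) : |s t n| ≤ c :=
  ((single_le_sum (f := fun n => |s t n|) (fun _ _ => abs_nonneg _) (mem_univ n)).trans
    (single_le_sum (f := fun t => ∑ n, |s t n|)
      (fun _ _ => sum_nonneg fun _ _ => abs_nonneg _) (mem_univ t))).trans h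

theorem continuous_dot_left (x : Prospect T N) : Continuous fun s : Prospect T N => dot s x := by
  unfold dot; fun_prop

theorem continuous_l1norm : Continuous (l1norm : Prospect T N → ℝ) := by
  unfold l1norm; fun_prop

theorem isCompact_slopes (c : ℝ) :
    IsCompact {s : Prospect T N | (∀ t n, 0 ≤ s t n) ∧ l1norm s ≤ c} := by
  have hS : {s : Prospect T N | (∀ t n, 0 ≤ s t n) ∧ l1norm s ≤ c} =
      (⋂ t, ⋂ n, {s | 0 ≤ s t n}) ∩ {s | l1norm s ≤ c} := by
    ext s; simp
  refine (isCompact_Icc (a := (fun _ _ => -c : Prospect T N)) (b := fun _ _ => c)).of_isClosed_subset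
    ?_ ?_
  · rw [hS]
    exact (isClosed_iInter fun t => isClosed_iInter fun n =>
      isClosed_le continuous_const (by fun_prop)).inter
        (isClosed_le continuous_l1norm continuous_const)
  · rintro s ⟨-, hs⟩
    exact ⟨fun t n => (abs_le.1 (abs_le_of_l1norm_le hs t n)).1,
      fun t n => (abs_le.1 (abs_le_of_l1norm_le hs t n)).2⟩

/-- Majorization survives raising the value at `θ`, whereas the equations for elicited pairs do not,
and `IsSlope` omits them. Slopes for `c + 1/(m+1)` lie in a compact set, and a limit point serves
for `c` itself. -/
theorem exists_isSlope_of_permLPValue_le (d : Elicitation T N K) {θ : Prospect T N}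
    {D : SortedList T N} {c : ℝ} (h : d.permLPValue θ D ≤ c) :
    ∃ s, d.IsSlope {p | p ∈ D} θ c s := by
  have hex : ∀ m : ℕ, ∃ s, d.IsSlope {p | p ∈ D} θ (c + 1 / (m + 1)) s := by
    intro m
    have hlt : d.permLPValue θ D < ((c + 1 / (m + 1) : ℝ) : EReal) := by
      refine h.trans_lt (EReal.coe_lt_coe_iff.2 ?_)
      have : (0 : ℝ) < 1 / (m + 1) := by positivity
      linarith
    simp only [permLPValue, iInf_lt_iff] at hlt
    obtain ⟨v, s, hs, hv⟩ := hlt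
    have hv' := EReal.coe_lt_coe_iff.1 hv
    exact ⟨s, fun p hp σ => by linarith [hs.majorize p hp σ], hs.nonneg, hs.norm_le⟩
  choose s hs using hex
  obtain ⟨a, ha, φ, hφ, hlim⟩ := (isCompact_slopes d.C).tendsto_subseq
    fun m => ⟨(hs m).nonneg, (hs m).norm_le⟩
  refine ⟨a, fun p hp σ => ?_, ha.1, ha.2⟩
  have h1 : Filter.Tendsto (fun m => c + 1 / ((φ m : ℝ) + 1) +
      dot (s (φ m)) (permute σ p.1 - θ)) Filter.atTop
      (nhds (c + 0 + dot a (permute σ p.1 - θ))) :=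
    (tendsto_const_nhds.add (tendsto_one_div_add_atTop_nhds_zero_nat.comp hφ.tendsto_atTop)).add
      (((continuous_dot_left _).tendsto a).comp hlim)
  rw [add_zero] at h1
  exact ge_of_tendsto' h1 fun m => (hs (φ m)).majorize p hp σ

theorem permLPValue_le (d : Elicitation T N K) {θ : Prospect T N} {D : SortedList T N} {v : ℝ}
    {s : Prospect T N} (h : d.PermFeasible θ D v s) : d.permLPValue θ D ≤ v :=
  iInf_le_of_le v (iInf_le_of_le s (iInf_le_of_le h le_rfl))

theorem le_permLPValue (d : Elicitation T N K) {θ : Prospect T N} {D : SortedList T N} {c : ℝ}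
    (h : ∀ v s, d.PermFeasible θ D v s → c ≤ v) : (c : EReal) ≤ d.permLPValue θ D :=
  le_iInf fun v => le_iInf fun s => le_iInf fun hs => EReal.coe_le_coe_iff.2 (h v s hs)

/-- A permutation of a sorted prospect has at least the value of that prospect. -/
theorem le_permLPValue_permute (d : Elicitation T N K) {D : SortedList T N}
    {p : Prospect T N × ℝ} (hp : p ∈ D) (σ : Equiv.Perm (Fin T)) :
    (p.2 : EReal) ≤ d.permLPValue (permute σ p.1) D :=
  d.le_permLPValue fun v s h => by
    have := h.majorize p hp σ
    rw [dot_sub, sub_self, add_zero] at this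
    exact this

theorem le_permLPValue_elicit (d : Elicitation T N K) {D : SortedList T N}
    {p : Prospect T N × ℝ} (hp : p ∈ D) {k : Fin K} (hk : d.Y k = p.1) :
    (p.2 : EReal) ≤ d.permLPValue (d.W k) D :=
  d.le_permLPValue fun _ _ h => (h.elicit p hp k rfl hk).ge

theorem dot_le_of_l1norm_le {s x : Prospect T N} {c : ℝ} (h : l1norm s ≤ c) :
    dot s x ≤ c * l1norm x := by
  simp only [dot, l1norm, mul_sum]
  refine sum_le_sum fun t _ => sum_le_sum fun n _ => ?_
  calc s t n * x t n ≤ |s t n * x t n| := le_abs_self _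
    _ = |s t n| * |x t n| := abs_mul _ _
    _ ≤ c * |x t n| := mul_le_mul_of_nonneg_right (abs_le_of_l1norm_le h t n) (abs_nonneg _)

/-- One sorted prospect suffices: bounded slopes cannot drop arbitrarily far below its value. -/
theorem permLPValue_ne_bot (d : Elicitation T N K) {θ : Prospect T N} {D : SortedList T N}
    {p : Prospect T N × ℝ} (hp : p ∈ D) : d.permLPValue θ D ≠ ⊥ := by
  refine ne_bot_of_le_ne_bot (EReal.coe_ne_bot _)
    (d.le_permLPValue (c := p.2 - d.C * l1norm (permute 1 p.1 - θ)) fun v s h => ?_)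
  linarith [h.majorize p hp 1, dot_le_of_l1norm_le (x := permute 1 p.1 - θ) h.norm_le]

/-! ### The predictor -/

/-- The predictor `π_L(θ; D)`, where `last` is the value of the prospect sorted last. -/
noncomputable def predictor (d : Elicitation T N K) (D : SortedList T N) (last : ℝ)
    (θ : Prospect T N) : EReal :=
  min (last : EReal) (d.permLPValue θ D)

theorem exists_isSlope_of_predictor_lt (d : Elicitation T N K) {θ : Prospect T N}
    {D : SortedList T N} {last r : ℝ} (h : d.predictor D last θ ≤ r) (hr : r < last) :
    ∃ s, d.IsSlope {p | p ∈ D} θ r s := by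
  refine d.exists_isSlope_of_permLPValue_le ((min_le_iff.1 h).resolve_left ?_)
  exact not_le.2 (EReal.coe_lt_coe_iff.2 hr)

theorem ThetaL_permute (d : Elicitation T N K) {θ : Prospect T N} (h : θ ∈ d.ThetaL)
    (σ : Equiv.Perm (Fin T)) : permute σ θ ∈ d.ThetaL := by
  obtain ⟨x, hx, hθ⟩ := mem_biUnion.1 h
  obtain ⟨τ, -, rfl⟩ := mem_image.1 hθ
  exact mem_biUnion.2 ⟨x, hx, mem_image.2 ⟨τ * σ, mem_univ _, rfl⟩⟩

/-- If the sorted values are lower bounds of the values of a feasible solution of the value problem,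
then so is the predictor. -/
theorem predictor_le (d : Elicitation T N K) {D : SortedList T N} {last : ℝ}
    (hΘ : ∀ p ∈ D, p.1 ∈ d.Theta) (hlast : ∀ p ∈ D, last ≤ p.2)
    {v : d.ThetaL → ℝ} {s : d.ThetaL → Prospect T N} (hv : d.ValueFeasible v s)
    (hD : ∀ p ∈ D, ∀ (x : d.ThetaL) (σ : Equiv.Perm (Fin T)), x.1 = permute σ p.1 → p.2 ≤ v x)
    {θ : Prospect T N} (x : d.ThetaL) (σ : Equiv.Perm (Fin T)) (hx : x.1 = permute σ θ) :
    d.predictor D last θ ≤ v x := by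
  -- Either some sorted value, and hence `last`, is at most `v x`, or `v x` lies strictly below all
  -- sorted values and yields a feasible point of the program at `θ`, with its slope permuted back.
  by_cases hex : ∃ p ∈ D, p.2 ≤ v x
  · obtain ⟨p, hp, hpv⟩ := hex
    exact (min_le_left _ _).trans (EReal.coe_le_coe_iff.2 ((hlast p hp).trans hpv))
  push Not at hex
  refine (min_le_right _ _).trans (d.permLPValue_le (s := permute σ⁻¹ (s x)) ⟨?_, ?_, ?_, ?_⟩)
  · intro p hp τ
    let z : d.ThetaL :=
      ⟨permute σ (permute τ p.1), d.ThetaL_permute (d.ThetaL_permute (d.mem_ThetaL (hΘ p hp)) τ) σ⟩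
    have hz : p.2 ≤ v z := hD p hp z (τ * σ) rfl
    have hne : x ≠ z := fun h => (hex p hp).not_ge (h ▸ hz)
    have h1 := hz.trans (hv.majorize x z hne)
    have h2 : dot (permute σ⁻¹ (s x)) (permute τ p.1 - θ) = dot (s x) (z.1 - x.1) := by
      rw [← dot_permute_permute σ, permute_permute_inv, permute_sub, hx]
    rw [h2]
    -- A maximum equal to 0 would give `p.2 ≤ v x`, which is excluded.
    rcases max_cases (dot (s x) (z.1 - x.1)) 0 with ⟨h3, -⟩ | ⟨h3, -⟩ <;> rw [h3] at h1
    · exact h1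
    · linarith [hex p hp]
  · exact fun t n => hv.nonneg _ _ _
  · rw [l1norm_permute]; exact hv.norm_le x
  · intro p hp k hW hY
    -- An elicited pair would also give `p.2 ≤ v x`, so the equation is vacuous.
    have h1 := hD p hp ⟨p.1, d.mem_ThetaL (hΘ p hp)⟩ 1 rfl
    have h2 := hv.elicit x ⟨p.1, d.mem_ThetaL (hΘ p hp)⟩ ⟨k, σ, 1, by rw [hx, hW], hY.symm⟩
    linarith [hex p hp]

/-! ### The loop invariant -/

theorem mem_unsorted (d : Elicitation T N K) {D : SortedList T N} {θ : Prospect T N} :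
    θ ∈ d.unsorted D ↔ θ ∈ d.Theta ∧ θ ∉ D.map Prod.fst := mem_filter

/-- The invariant of the sorting algorithm. -/
structure Invariant (d : Elicitation T N K) (D : SortedList T N) (last : ℝ) : Prop where
  nodup : (D.map Prod.fst).Nodup
  mem_Theta : ∀ p ∈ D, p.1 ∈ d.Theta
  sorted : D.Pairwise fun p q => q.2 ≤ p.2
  init_mem : (d.W₀, 0) ∈ D
  last_le : ∀ p ∈ D, last ≤ p.2
  le_feasible : ∀ v s, d.ValueFeasible v s → ∀ p ∈ D, ∀ (x : d.ThetaL)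
    (σ : Equiv.Perm (Fin T)), x.1 = permute σ p.1 → p.2 ≤ v x
  -- Only strictly larger values need majorization by the slope.
  slope_sorted : ∀ p ∈ D, ∃ s, d.IsSlope {q | q ∈ D ∧ p.2 < q.2} p.1 p.2 s
  slope_unsorted : ∀ θ ∈ d.unsorted D, ∃ s, d.IsSlope {q | q ∈ D ∧ last < q.2} θ last s
  permute_sorted : ∀ p ∈ D, ∀ q ∈ D, ∀ σ : Equiv.Perm (Fin T), q.1 = permute σ p.1 → q.2 = p.2
  -- The running value cannot fall below that of a sorted prospect while a permutation of it is
  -- unsorted. `elicit_unsorted` says the same of `Y k` and `W k`.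
  permute_unsorted : ∀ p ∈ D, ∀ σ : Equiv.Perm (Fin T), permute σ p.1 ∈ d.unsorted D → p.2 = last
  elicit_sorted : ∀ k, ∀ p ∈ D, ∀ q ∈ D, p.1 = d.W k → q.1 = d.Y k → q.2 ≤ p.2
  elicit_unsorted : ∀ k, ∀ q ∈ D, q.1 = d.Y k → d.W k ∈ d.unsorted D → q.2 = last

theorem W₀_mem_Theta (d : Elicitation T N K) : d.W₀ ∈ d.Theta := mem_insert_self _ _

theorem W_mem_Theta (d : Elicitation T N K) (k : Fin K) : d.W k ∈ d.Theta :=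
  mem_insert_of_mem (mem_union_left _ (mem_image_of_mem _ (mem_univ k)))

theorem Y_mem_Theta (d : Elicitation T N K) (k : Fin K) : d.Y k ∈ d.Theta :=
  mem_insert_of_mem (mem_union_right _ (mem_image_of_mem _ (mem_univ k)))

theorem isSlope_zero (d : Elicitation T N K) (hC : 0 ≤ d.C) {D : Set (Prospect T N × ℝ)}
    (θ : Prospect T N) {c : ℝ} (h : ∀ p ∈ D, p.2 ≤ c) : d.IsSlope D θ c 0 where
  majorize p hp σ := by simpa [dot] using h p hp
  nonneg t n := le_rfl
  norm_le := by simpa [l1norm] using hC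

theorem invariant_init (d : Elicitation T N K) (hC : 0 ≤ d.C) :
    d.Invariant [(d.W₀, 0)] 0 where
  nodup := by simp
  mem_Theta := by simpa using d.W₀_mem_Theta
  sorted := by simp
  init_mem := by simp
  last_le := by simp
  le_feasible v s hv p hp x σ hx := by
    obtain rfl := List.mem_singleton.1 hp
    exact (hv.normalize x σ hx).ge
  slope_sorted p hp := by
    obtain rfl := List.mem_singleton.1 hp
    exact ⟨0, d.isSlope_zero hC _ fun q hq => by rw [List.mem_singleton.1 hq.1]⟩
  slope_unsorted θ _ := ⟨0, d.isSlope_zero hC _ fun q hq => by rw [List.mem_singleton.1 hq.1]⟩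
  permute_sorted p hp q hq _ _ := by rw [List.mem_singleton.1 hp, List.mem_singleton.1 hq]
  permute_unsorted p hp _ _ := by rw [List.mem_singleton.1 hp]
  elicit_sorted k p hp q hq _ _ := by rw [List.mem_singleton.1 hp, List.mem_singleton.1 hq]
  elicit_unsorted k q hq _ _ := by rw [List.mem_singleton.1 hq]

theorem mem_unsorted_of_append (d : Elicitation T N K) {D : SortedList T N}
    {p : Prospect T N × ℝ} {θ : Prospect T N} (h : θ ∈ d.unsorted (D ++ [p])) :
    θ ∈ d.unsorted D := by
  rw [mem_unsorted] at h ⊢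
  exact ⟨h.1, fun h' => h.2 (by simpa using Or.inl (by simpa using h'))⟩

theorem Invariant.append {d : Elicitation T N K} {D : SortedList T N} {last : ℝ}
    (h : d.Invariant D last) {θ : Prospect T N} (hθ : θ ∈ d.unsorted D) {r : ℝ}
    (hr : d.predictor D last θ = r) (hmax : ∀ x ∈ d.unsorted D, d.predictor D last x ≤ r) :
    d.Invariant (D ++ [(θ, r)]) r := by
  have hrl : r ≤ last := EReal.coe_le_coe_iff.1 (hr ▸ min_le_left _ _)
  -- One unsorted prospect whose program has value at least `last` keeps the maximal predictor at
  -- `last`.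
  have htop : ∀ x ∈ d.unsorted D, (last : EReal) ≤ d.permLPValue x D → r = last := fun x hx hl =>
    le_antisymm hrl (EReal.coe_le_coe_iff.1 ((le_min le_rfl hl).trans (hmax x hx)))
  have hperm : ∀ p ∈ D, ∀ σ : Equiv.Perm (Fin T), permute σ p.1 ∈ d.unsorted D → p.2 = r := by
    intro p hp σ hx
    have h1 := h.permute_unsorted p hp σ hx
    rw [htop _ hx (h1 ▸ d.le_permLPValue_permute hp σ), h1]
  have helicit : ∀ k, ∀ q ∈ D, q.1 = d.Y k → d.W k ∈ d.unsorted D → q.2 = r := by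
    intro k q hq hY hx
    have h1 := h.elicit_unsorted k q hq hY hx
    rw [htop _ hx (h1 ▸ d.le_permLPValue_elicit hq hY.symm), h1]
  have hle : ∀ p ∈ D, r ≤ p.2 := fun p hp => hrl.trans (h.last_le p hp)
  have hslope : ∀ x ∈ d.unsorted D,
      ∃ s, d.IsSlope {q | q ∈ D ++ [(θ, r)] ∧ r < q.2} x r s := by
    intro x hx
    have hmem : ∀ q, q ∈ D ++ [(θ, r)] ∧ r < q.2 → q ∈ D := by
      rintro q ⟨hq, hlt⟩
      refine (List.mem_append.1 hq).resolve_right fun hq => ?_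
      rw [List.mem_singleton.1 hq] at hlt
      exact lt_irrefl _ hlt
    -- If the value drops, the cap `last` is inactive and the program supplies slopes. If it does
    -- not, the program may be infeasible, but no new strictly larger values appear and the old
    -- slopes still serve.
    rcases hrl.lt_or_eq with hlt | rfl
    · obtain ⟨s, hs⟩ := d.exists_isSlope_of_predictor_lt (hmax x hx) hlt
      exact ⟨s, fun q hq => hs.majorize q (hmem q hq), hs.nonneg, hs.norm_le⟩
    · obtain ⟨s, hs⟩ := h.slope_unsorted x hx
      exact ⟨s, fun q hq => hs.majorize q ⟨hmem q hq, hq.2⟩, hs.nonneg, hs.norm_le⟩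
  have hθ' := d.mem_unsorted.1 hθ
  refine ⟨?_, ?_, ?_, ?_, ?_, ?_, ?_, ?_, ?_, ?_, ?_, ?_⟩
  · rw [List.map_append, List.nodup_append]
    refine ⟨h.nodup, by simp, ?_⟩
    rintro a ha b hb rfl
    simp only [List.map_cons, List.map_nil, List.mem_singleton] at hb
    exact hθ'.2 (hb ▸ ha)
  · simp only [List.forall_mem_append, List.forall_mem_singleton]
    exact ⟨h.mem_Theta, hθ'.1⟩
  · rw [List.pairwise_append]
    refine ⟨h.sorted, List.pairwise_singleton _ _, fun p hp q hq => ?_⟩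
    rw [List.mem_singleton.1 hq]
    exact hle p hp
  · exact List.mem_append_left _ h.init_mem
  · simp only [List.forall_mem_append, List.forall_mem_singleton]
    exact ⟨hle, le_rfl⟩
  · intro v s hv
    simp only [List.forall_mem_append, List.forall_mem_singleton]
    refine ⟨h.le_feasible v s hv, fun x σ hx => EReal.coe_le_coe_iff.1 ?_⟩
    rw [← hr]
    exact d.predictor_le h.mem_Theta h.last_le hv (h.le_feasible v s hv) x σ hx
  · intro p hp
    rcases List.mem_append.1 hp with hp | hp
    · obtain ⟨s, hs⟩ := h.slope_sorted p hp
      refine ⟨s, fun q hq => hs.majorize q ⟨?_, hq.2⟩, hs.nonneg, hs.norm_le⟩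
      refine (List.mem_append.1 hq.1).resolve_right fun hq' => ?_
      have := hq.2
      rw [List.mem_singleton.1 hq'] at this
      exact (hle p hp).not_gt this
    · obtain rfl := List.mem_singleton.1 hp
      exact hslope θ hθ
  · exact fun x hx => hslope x (d.mem_unsorted_of_append hx)
  · simp only [List.forall_mem_append, List.forall_mem_singleton]
    refine ⟨fun p hp => ⟨h.permute_sorted p hp, fun σ hσ => ?_⟩, fun q hq σ hσ => ?_, fun _ _ => trivial⟩
    · exact (hperm p hp σ (hσ ▸ hθ)).symm
    · refine hperm q hq σ⁻¹ ?_
      rw [hσ, permute_inv_permute]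
      exact hθ
  · simp only [List.forall_mem_append, List.forall_mem_singleton]
    exact ⟨fun p hp σ hx => hperm p hp σ (d.mem_unsorted_of_append hx), fun _ _ => trivial⟩
  · simp only [List.forall_mem_append, List.forall_mem_singleton]
    refine fun k => ⟨fun p hp => ⟨h.elicit_sorted k p hp, fun _ _ => hle p hp⟩,
      fun q hq hW hY => ?_, fun _ _ => le_rfl⟩
    exact (helicit k q hq hY (hW ▸ hθ)).le
  · simp only [List.forall_mem_append, List.forall_mem_singleton]
    exact fun k => ⟨fun q hq hY hx => helicit k q hq hY (d.mem_unsorted_of_append hx),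
      fun _ _ => trivial⟩

end Elicitation

/-! ### Execution of the sorting algorithm -/

theorem OracleProg.exec_bind {Q A α β : Type} (o : Q → A) (p : OracleProg Q A α)
    (f : α → OracleProg Q A β) :
    (p.bind f).exec o =
      (((f (p.exec o).1).exec o).1, (p.exec o).2 ++ ((f (p.exec o).1).exec o).2) := by
  induction p with
  | done a => rfl
  | ask q next ih => simp only [bind, exec, ih, List.cons_append]

namespace Elicitation

theorem exec_predictAll (o : Query T N → EReal) (D : SortedList T N) (last : ℝ)
    (l : List (Prospect T N)) :
    (predictAll D last l).exec o =
      (l.map fun θ => (θ, min (last : EReal) (o (θ, D))), l.map fun θ => (θ, D)) := by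
  induction l with
  | nil => rfl
  | cons θ l ih =>
    simp only [predictAll, OracleProg.exec, OracleProg.exec_bind, ih, List.map_cons, List.append_nil]

theorem exec_predictAll_lpOracle (d : Elicitation T N K) (D : SortedList T N) (last : ℝ)
    (l : List (Prospect T N)) :
    (predictAll D last l).exec d.lpOracle =
      (l.map fun θ => (θ, d.predictor D last θ), l.map fun θ => (θ, D)) := by
  simp only [exec_predictAll, lpOracle, reducedLP_value_eq, predictor]

theorem unsorted_append (d : Elicitation T N K) (D : SortedList T N) (θ : Prospect T N) (r : ℝ) :
    d.unsorted (D ++ [(θ, r)]) = (d.unsorted D).erase θ := by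
  ext x
  simp only [mem_unsorted, mem_erase, List.map_append, List.mem_append, List.map_cons,
    List.map_nil, List.mem_singleton]
  tauto

theorem exec_sortLoop (d : Elicitation T N K) {pick : SelectionRule T N} (hpick : pick.IsArgmax)
    (m : ℕ) (D : SortedList T N) (last : ℝ) (h : d.Invariant D last)
    (hm : #(d.unsorted D) = m) :
    ∃ (D' : SortedList T N) (last' : ℝ) (queries : List (Query T N)),
      (d.sortLoop pick m D last).exec d.lpOracle = (some D', queries) ∧
      D <+: D' ∧ d.Invariant D' last' ∧ d.unsorted D' = ∅ ∧ queries.length ≤ m ^ 2 ∧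
      ∀ q ∈ queries, q.1 ∈ d.Theta ∧ q.2 <+: D' := by
  induction m generalizing D last with
  | zero => exact ⟨D, last, [], rfl, List.prefix_rfl, h, card_eq_zero.1 hm, by simp, by simp⟩
  | succ m ih =>
    set c := (d.unsorted D).toList.map fun θ => (θ, d.predictor D last θ) with hc
    have hne : c ≠ [] := by
      intro h0
      have := congrArg List.length h0
      rw [hc, List.length_map, length_toList, hm, List.length_nil] at this
      omega
    obtain ⟨hmem, hmax⟩ := hpick D c hne
    obtain ⟨θ, hθ, hθp⟩ := List.mem_map.1 hmem
    rw [mem_toList] at hθ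
    have hmax' : ∀ x ∈ d.unsorted D, d.predictor D last x ≤ d.predictor D last θ := by
      intro x hx
      have := hmax _ (List.mem_map.2 ⟨x, mem_toList.2 hx, rfl⟩)
      rwa [← hθp] at this
    -- Finiteness: the normalizing pair in the list excludes `⊥`, and the cap `last` excludes `⊤`.
    have hbot : d.predictor D last θ ≠ ⊥ := by
      rw [predictor, ne_eq, min_eq_bot, not_or]
      exact ⟨EReal.coe_ne_bot _, d.permLPValue_ne_bot h.init_mem⟩
    have htop : d.predictor D last θ ≠ ⊤ :=
      ne_top_of_le_ne_top (EReal.coe_ne_top last) (min_le_left _ _)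
    have hr := (EReal.coe_toReal htop hbot).symm
    set r := (d.predictor D last θ).toReal
    have hcard : #(d.unsorted (D ++ [(θ, r)])) = m := by
      rw [unsorted_append, card_erase_of_mem hθ, hm, Nat.add_sub_cancel]
    obtain ⟨D', last', qs, hexec, hpre, hinv, hempty, hlen, hqs⟩ :=
      ih _ _ (h.append hθ hr (hr ▸ hmax')) hcard
    have hDD' : D <+: D' := (List.prefix_append _ _).trans hpre
    refine ⟨D', last', (d.unsorted D).toList.map (fun θ => (θ, D)) ++ qs, ?_, hDD', hinv, hempty,
      ?_, ?_⟩
    · simp only [sortLoop, OracleProg.exec_bind, exec_predictAll_lpOracle, ← hc, ← hθp]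
      rw [if_neg (not_or.2 ⟨hbot, htop⟩), hexec]
    -- This round solves `m + 1` instances and the later ones at most `m ^ 2`.
    · rw [List.length_append, List.length_map, length_toList, hm]
      nlinarith
    · intro q hq
      rcases List.mem_append.1 hq with hq | hq
      · obtain ⟨x, hx, rfl⟩ := List.mem_map.1 hq
        exact ⟨(d.mem_unsorted.1 (mem_toList.1 hx)).1, hDD'⟩
      · exact hqs q hq

theorem card_Theta_le (d : Elicitation T N K) : #d.Theta ≤ d.J := by
  refine (card_insert_le _ _).trans (Nat.succ_le_succ ((card_union_le _ _).trans ?_))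
  have h1 : #(univ.image d.W) ≤ K := card_image_le.trans (card_fin K).le
  have h2 : #(univ.image d.Y) ≤ K := card_image_le.trans (card_fin K).le
  omega

theorem exec_sortingAlgorithm (d : Elicitation T N K) (hC : 0 ≤ d.C) {pick : SelectionRule T N}
    (hpick : pick.IsArgmax) :
    ∃ (D : SortedList T N) (last : ℝ) (queries : List (Query T N)),
      (d.sortingAlgorithm pick).exec d.lpOracle = (some D, queries) ∧
      d.Invariant D last ∧ d.unsorted D = ∅ ∧ queries.length ≤ d.J ^ 2 ∧
      ∀ q ∈ queries, q.1 ∈ d.Theta ∧ q.2 <+: D := by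
  have hcard : #(d.unsorted [(d.W₀, 0)]) = #d.Theta - 1 := by
    rw [← card_erase_of_mem d.W₀_mem_Theta]
    congr 1
    ext x
    simp [mem_unsorted, and_comm]
  obtain ⟨D, last, qs, h1, -, h2, h3, h4, h5⟩ :=
    d.exec_sortLoop hpick _ _ _ (d.invariant_init hC) hcard
  exact ⟨D, last, qs, h1, h2, h3,
    h4.trans (Nat.pow_le_pow_left ((Nat.sub_le _ _).trans d.card_Theta_le) 2), h5⟩

/-! ### Optimality of the sorted values -/

theorem exists_mem_permute (d : Elicitation T N K) {D : SortedList T N} (hD : d.unsorted D = ∅)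
    (x : d.ThetaL) : ∃ p ∈ D, ∃ σ : Equiv.Perm (Fin T), x.1 = permute σ p.1 := by
  obtain ⟨θ, hθ, hx⟩ := mem_biUnion.1 x.2
  obtain ⟨σ, -, hσ⟩ := mem_image.1 hx
  have hmem : θ ∈ D.map Prod.fst := by
    by_contra hne
    exact notMem_empty θ (hD ▸ d.mem_unsorted.2 ⟨hθ, hne⟩)
  obtain ⟨p, hp, rfl⟩ := List.mem_map.1 hmem
  exact ⟨p, hp, σ, hσ.symm⟩

/-- The law invariant extension of the sorted values to `Θ_L`. -/
theorem Invariant.exists_extension {d : Elicitation T N K} {D : SortedList T N} {last : ℝ}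
    (h : d.Invariant D last) (hD : d.unsorted D = ∅) :
    ∃ v : d.ThetaL → ℝ, ∀ x, ∀ p ∈ D, ∀ σ : Equiv.Perm (Fin T), x.1 = permute σ p.1 →
      v x = p.2 := by
  choose p hp σ hσ using d.exists_mem_permute hD
  -- Two representations of `x` have sorted prospects that are permutations of each other, so their
  -- values agree.
  refine ⟨fun x => (p x).2, fun x q hq τ hτ => h.permute_sorted q hq _ (hp x) (τ * (σ x)⁻¹) ?_⟩
  rw [← permute_permute, ← hτ, hσ, permute_inv_permute]

theorem Invariant.feasible {d : Elicitation T N K} {D : SortedList T N} {last : ℝ}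
    (h : d.Invariant D last) (hD : d.unsorted D = ∅) {v : d.ThetaL → ℝ}
    (hv : ∀ x, ∀ p ∈ D, ∀ σ : Equiv.Perm (Fin T), x.1 = permute σ p.1 → v x = p.2) :
    ∃ s, d.ValueFeasible v s := by
  choose p hp σ hσ using d.exists_mem_permute hD
  choose s hs using fun x => h.slope_sorted (p x) (hp x)
  refine ⟨fun x => permute (σ x) (s x), ?_, ?_, ?_, ?_, ?_⟩
  · intro x z _
    rw [hv x (p x) (hp x) _ (hσ x), hv z (p z) (hp z) _ (hσ z)]
    rcases le_or_gt (p z).2 (p x).2 with hle | hlt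
    · linarith [le_max_right (dot (permute (σ x) (s x)) (z.1 - x.1)) 0]
    -- This permutation is chosen so that a further permutation by `σ x` turns `(p z).1` into `z`.
    · have h1 := (hs x).majorize _ ⟨hp z, hlt⟩ (σ z * (σ x)⁻¹)
      rw [← dot_permute_permute (σ x), permute_sub, ← hσ x, permute_permute, mul_assoc,
        inv_mul_cancel, mul_one, ← hσ z] at h1
      linarith [le_max_left (dot (permute (σ x) (s x)) (z.1 - x.1)) 0]
  · exact fun x t n => (hs x).nonneg _ _
  · intro x
    rw [l1norm_permute]
    exact (hs x).norm_le
  · rintro x z ⟨k, τ, τ', hx, hz⟩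
    have hmem : ∀ θ ∈ d.Theta, ∃ q ∈ D, q.1 = θ := by
      intro θ hθ
      by_contra hne
      refine notMem_empty θ (hD ▸ d.mem_unsorted.2 ⟨hθ, fun hm => hne ?_⟩)
      obtain ⟨q, hq, rfl⟩ := List.mem_map.1 hm
      exact ⟨q, hq, rfl⟩
    obtain ⟨a, ha, haW⟩ := hmem _ (d.W_mem_Theta k)
    obtain ⟨b, hb, hbY⟩ := hmem _ (d.Y_mem_Theta k)
    rw [hv x a ha τ (haW ▸ hx), hv z b hb τ' (hbY ▸ hz)]
    exact h.elicit_sorted k a ha b hb haW hbY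
  · exact fun x τ hx => hv x _ h.init_mem τ hx

theorem Invariant.le_of_feasible {d : Elicitation T N K} {D : SortedList T N} {last : ℝ}
    (h : d.Invariant D last) (hD : d.unsorted D = ∅) {v : d.ThetaL → ℝ}
    (hv : ∀ x, ∀ p ∈ D, ∀ σ : Equiv.Perm (Fin T), x.1 = permute σ p.1 → v x = p.2)
    {v' : d.ThetaL → ℝ} {s' : d.ThetaL → Prospect T N} (hv' : d.ValueFeasible v' s') (x : d.ThetaL) :
    v x ≤ v' x := by
  obtain ⟨p, hp, σ, hσ⟩ := d.exists_mem_permute hD x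
  rw [hv x p hp σ hσ]
  exact h.le_feasible v' s' hv' p hp x σ hσ

theorem Invariant.isDecomposition {d : Elicitation T N K} {D : SortedList T N} {last : ℝ}
    (h : d.Invariant D last) (hD : d.unsorted D = ∅) {v : d.ThetaL → ℝ}
    (hv : ∀ x, ∀ p ∈ D, ∀ σ : Equiv.Perm (Fin T), x.1 = permute σ p.1 → v x = p.2) :
    d.IsDecomposition v D := by
  have hmem : ∀ θ ∈ d.Theta, θ ∈ D.map Prod.fst := by
    intro θ hθ
    by_contra hne
    exact notMem_empty θ (hD ▸ d.mem_unsorted.2 ⟨hθ, hne⟩)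
  refine ⟨h.nodup, fun θ => ⟨fun hθ => ?_, hmem θ⟩, fun θ hθ => ?_, h.sorted⟩
  · obtain ⟨p, hp, rfl⟩ := List.mem_map.1 hθ
    exact h.mem_Theta p hp
  · obtain ⟨p, hp, rfl⟩ := List.mem_map.1 (hmem θ hθ)
    rw [hv ⟨p.1, d.mem_ThetaL hθ⟩ p hp 1 rfl]
    exact hp

/-- The extension lies pointwise below every feasible solution, so equality of the sums forces
equality in each coordinate. -/
theorem Invariant.exists_value {d : Elicitation T N K} {D : SortedList T N} {last : ℝ}
    (h : d.Invariant D last) (hD : d.unsorted D = ∅) :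
    ∃ v : d.ThetaL → ℝ, d.ValueOptimal v ∧ (∀ v', d.ValueOptimal v' → v' = v) ∧
      (∀ (θ θ' : d.ThetaL) (σ : Equiv.Perm (Fin T)), θ'.1 = permute σ θ.1 → v θ' = v θ) ∧
      d.IsDecomposition v D := by
  obtain ⟨v, hv⟩ := h.exists_extension hD
  have hle : ∀ v' s', d.ValueFeasible v' s' → ∀ x, v x ≤ v' x :=
    fun _ _ hv' => h.le_of_feasible hD hv hv'
  refine ⟨v, ⟨h.feasible hD hv, fun v' s' hv' => sum_le_sum fun x _ => hle v' s' hv' x⟩,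
    ?_, ?_, h.isDecomposition hD hv⟩
  · rintro v' ⟨⟨s', hs'⟩, hmin⟩
    obtain ⟨s, hs⟩ := h.feasible hD hv
    have hsum := (sum_le_sum fun x _ => hle v' s' hs' x).antisymm (hmin v s hs)
    funext x
    exact ((sum_eq_sum_iff_of_le fun x _ => hle v' s' hs' x).1 hsum x (mem_univ x)).symm
  · intro x z τ hz
    obtain ⟨p, hp, σ, hσ⟩ := d.exists_mem_permute hD x
    rw [hv x p hp σ hσ, hv z p hp (σ * τ) (by rw [hz, hσ, permute_permute])]

/-! ### The size of the reduced programs -/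

theorem Invariant.length_le {d : Elicitation T N K} {D : SortedList T N} {last : ℝ}
    (h : d.Invariant D last) : D.length ≤ d.J := by
  rw [← List.length_map Prod.fst, ← List.toFinset_card_of_nodup h.nodup]
  refine (card_le_card fun θ hθ => ?_).trans d.card_Theta_le
  obtain ⟨p, hp, rfl⟩ := List.mem_map.1 (List.mem_toFinset.1 hθ)
  exact h.mem_Theta p hp

theorem numVars_reducedLP (d : Elicitation T N K) (θ : Prospect T N) (D : SortedList T N) :
    (d.reducedLP θ D).numVars = 1 + T * N + 2 * T * D.length := by
  simp only [LinearProgram.numVars, Fintype.card_sum, Fintype.card_prod, Fintype.card_fin,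
    Fintype.card_unit]
  ring

theorem numConstraints_reducedLP_le (d : Elicitation T N K) (θ : Prospect T N)
    (D : SortedList T N) :
    (d.reducedLP θ D).numConstraints ≤
      D.length + D.length * T ^ 2 + T * N + 1 + K * D.length := by
  have h : Fintype.card (d.ReducedEqn θ D) ≤ K * D.length := by
    refine (Fintype.card_subtype_le _).trans ?_
    simp
  simp only [LinearProgram.numConstraints, Fintype.card_sum, Fintype.card_prod, Fintype.card_fin,
    Fintype.card_unit]
  nlinarith

end Elicitation

/-- The existence of an optimal `v` is read off from a run of the algorithm, so at least one rule is
needed. -/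
theorem SelectionRule.exists_isArgmax (T N : ℕ) : ∃ pick : SelectionRule T N, pick.IsArgmax := by
  classical
  have h : ∀ c : List (Prospect T N × EReal), ∃ p : Prospect T N × EReal,
      c ≠ [] → p ∈ c ∧ ∀ q ∈ c, q.2 ≤ p.2 := by
    intro c
    rcases eq_or_ne c [] with rfl | hc
    -- Arbitrary default: nothing is required of a rule on the empty list.
    · exact ⟨(0, 0), fun h => absurd rfl h⟩
    obtain ⟨p, hp, hmax⟩ := c.toFinset.exists_max_image Prod.snd (List.toFinset_nonempty_iff c |>.2 hc)
    exact ⟨p, fun _ => ⟨List.mem_toFinset.1 hp, fun q hq => hmax q (List.mem_toFinset.2 hq)⟩⟩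
  choose f hf using h
  exact ⟨fun _ c => f c, fun _ c hc => hf c hc⟩

end LawRobust

theorem mainTheorem7 {T N K : ℕ} (d : LawRobust.Elicitation T N K) (hC : 0 < d.C) :
    -- the reduced program has the same value as the one with all permutation constraints
    (∀ (θ : LawRobust.Prospect T N) (D : LawRobust.SortedList T N),
      (d.reducedLP θ D).value = d.permLPValue θ D) ∧
    -- the value problem has a unique optimal solution, which is permutation invariant
    ∃ v : d.ThetaL → ℝ,
      d.ValueOptimal v ∧ (∀ v', d.ValueOptimal v' → v' = v) ∧
      (∀ (θ θ' : d.ThetaL) (σ : Equiv.Perm (Fin T)),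
        θ'.1 = LawRobust.permute σ θ.1 → v θ' = v θ) ∧
      -- the sorting algorithm computes it, however ties are broken
      ∀ pick : LawRobust.SelectionRule T N, pick.IsArgmax →
        ∃ (D : LawRobust.SortedList T N) (queries : List (LawRobust.Query T N)),
          (d.sortingAlgorithm pick).exec d.lpOracle = (some D, queries) ∧
          d.IsDecomposition v D ∧
          -- the number of instances solved
          queries.length ≤ d.J ^ 2 ∧
          -- the instances, and their size
          ∀ q ∈ queries, q.1 ∈ d.Theta ∧ q.2 <+: D ∧
            (d.reducedLP q.1 q.2).numVars ≤ 1 + T * N + 2 * T * d.J ∧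
            (d.reducedLP q.1 q.2).numConstraints ≤
              d.J + d.J * T ^ 2 + T * N + 1 + K * d.J := by
  refine ⟨d.reducedLP_value_eq, ?_⟩
  obtain ⟨pick₀, hpick₀⟩ := LawRobust.SelectionRule.exists_isArgmax T N
  obtain ⟨D₀, last₀, -, -, hinv₀, hempty₀, -⟩ := d.exec_sortingAlgorithm hC.le hpick₀
  obtain ⟨v, hopt, huniq, hperm, -⟩ := hinv₀.exists_value hempty₀
  refine ⟨v, hopt, huniq, hperm, fun pick hpick => ?_⟩
  obtain ⟨D, last, qs, hexec, hinv, hempty, hlen, hqs⟩ := d.exec_sortingAlgorithm hC.le hpick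
  obtain ⟨v', hopt', -, -, hdec⟩ := hinv.exists_value hempty
  -- Each run produces its own optimal solution; uniqueness identifies it with the `v` fixed before
  -- `pick`.
  obtain rfl := huniq v' hopt'
  refine ⟨D, qs, hexec, hdec, hlen, fun q hq => ?_⟩
  obtain ⟨hq1, hq2⟩ := hqs q hq
  have hl : q.2.length ≤ d.J := hq2.length_le.trans hinv.length_le
  refine ⟨hq1, hq2, ?_, (d.numConstraints_reducedLP_le _ _).trans ?_⟩
  · rw [d.numVars_reducedLP]
    gcongr
  · gcongr
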